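/- Let $(X,\rho)$ be a compact metric space and let $\mu_1,\mu_2$ be two Borel probability measures on $X$ that are continuous (every point has measure $0$). Let $$k=\inf_L\int_{X\times X}\rho(x,y)\,dL(x,y)$$ be the value of the Monge–Kantorovich problem, where $L$ runs over all Borel measures on $X\times X$ whose first and second marginals are $\mu_1$ and $\mu_2$. Let $S:(X,\mu_1)\to(X,\mu_2)$ be any isomorphism of measure spaces (mod $0$), that is, a Borel map with $S_*\mu_1=\mu_2$ that has a Borel inverse up to null sets, put $\mu=\mu_1$, and let $f(x,y)=\rho(x,Sy)$ be the shifted metric. Let $D^s_f$ be the symmetric matrix distribution of $f$, that is, the law of the random infinite matrix $r=(r_{i,j})_{i,j\ge1}$, $r_{i,j}=f(x_i,x_j)$, where $x_1,x_2,\dots$ are independent random points of $X$ with law $\mu$. For $n\ge1$ let $$k_n(r)=\frac1n\,\inf_{l}\sum_{i,j=1}^n l_{i,j}\,r_{i,j},$$ where $l$ runs over the bistochastic $n\times n$ matrices ($l_{i,j}\ge0$, $\sum_{i}l_{i,j}=\sum_{j}l_{i,j}=1$). Then $D^s_f$ is a probability measure on the space of infinite real matrices, each $k_n$ is a random variable (a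 measurable function of $r$), the problem for the shifted metric has the same value as the original one, $$k=\inf_L\int_{X\times X} f\,dL$$ with $L$ running over all Borel measures on $X\times X$ with both marginals equal to $\mu$, and $$\lim_{n\to\infty}k_n(r)=k\quad\text{in measure } D^s_f,$$ i.e. $D^s_f\{r:|k_n(r)-k|\ge\varepsilon\}\to0$ as $n\to\infty$ for every $\varepsilon>0$. -/

import Mathlib

open MeasureTheory Filter

noncomputable section

namespace MongeKantorovich

/-- A plan of transportation of `μ` to `ν`: a measure on the product with marginals `μ` and `ν`. -/
def IsPlan {X Y : Type*} [MeasurableSpace X] [MeasurableSpace Y]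
    (μ : Measure X) (ν : Measure Y) (L : Measure (X × Y)) : Prop :=
  L.map Prod.fst = μ ∧ L.map Prod.snd = ν

/-- The value `inf_L ∫ c(x, y) dL(x, y)` of the Monge-Kantorovich problem with cost `c`, the infimum
being over all plans `L` of transportation of `μ` to `ν`. -/
def mkValue {X Y : Type*} [MeasurableSpace X] [MeasurableSpace Y]
    (c : X → Y → ℝ) (μ : Measure X) (ν : Measure Y) : ℝ :=
  sInf {v : ℝ | ∃ L : Measure (X × Y), IsPlan μ ν L ∧ v = ∫ p, c p.1 p.2 ∂L}

/-- `S` is an isomorphism (mod 0) of the measure space `(X, μ)` onto the measure space `(Y, ν)`: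
it is measure-preserving and has a measure-preserving inverse up to null sets. -/
def IsIsomorphismModZero {X Y : Type*} [MeasurableSpace X] [MeasurableSpace Y]
    (μ : Measure X) (ν : Measure Y) (S : X → Y) : Prop :=
  MeasurePreserving S μ ν ∧
    ∃ T : Y → X, MeasurePreserving T ν μ ∧
      (∀ᵐ x ∂μ, T (S x) = x) ∧ (∀ᵐ y ∂ν, S (T y) = y)

/-- The shifted metric `f(x, y) = ρ(x, S y)`. -/
def shiftedMetric {X : Type*} [MetricSpace X] (S : X → X) : X → X → ℝ :=
  fun x y => dist x (S y)

/-- The symmetric matrix distribution of `f`: the law of the infinite matrix `r i j = f (x i) (x j)`,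
where the `x i` are independent with common law `μ`. Infinite real matrices are functions
`ℕ → ℕ → ℝ`, with the product sigma-algebra. -/
def symmMatrixDistribution {X : Type*} [MeasurableSpace X]
    (μ : Measure X) [IsProbabilityMeasure μ] (f : X → X → ℝ) : Measure (ℕ → ℕ → ℝ) :=
  (Measure.infinitePi (fun _ : ℕ => μ)).map (fun x i j => f (x i) (x j))

/-- The normalised value `(1/n) inf_l ∑ i j, l i j * r i j` of the `n × n` assignment problem whose
cost matrix is the `n`-fragment of `r`; here `l` runs over the bistochastic matrices, that is,
nonnegative matrices with all row sums and column sums equal to `1`. -/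
def assignmentValue (n : ℕ) (r : ℕ → ℕ → ℝ) : ℝ :=
  (n : ℝ)⁻¹ * sInf {v : ℝ | ∃ l : Matrix (Fin n) (Fin n) ℝ, l ∈ doublyStochastic ℝ (Fin n) ∧
    v = ∑ i : Fin n, ∑ j : Fin n, l i j * r i j}

end MongeKantorovich

end

/-! Equality of the two values: composing the second coordinate of a plan with `S` or with its
inverse mod 0 preserves marginals and costs, so both problems have the same set of costs
(`mkValue_comp_isomorphism`). Convergence: up to the factor `1/n`, bistochastic matrices are the
plans between uniform measures on `n` points, so `k_n` is the transport value of the empirical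
problem (`assignmentValue_eq_mkValue_uniformOn`). No continuity of `S` is needed: a finite label `α`
of `X` with fine cells, applied to `x` and to `S y`, approximates `ρ(x, S y)` uniformly by a
function of two labels. The value is stable under such an approximation, and changes by at most the
diameter times the `ℓ¹` distances of the label distributions (`abs_mkValue_sub_le_of_labels`). For
the empirical problem these distributions are sample frequencies, which converge by the strong law
(`tendsto_frequency`). This gives almost sure convergence, hence convergence in measure. -/

namespace MongeKantorovich

/-! ### Transportation between finite label spaces -/

/-- A transportation matrix can be corrected to have prescribed new marginals, the cost growing by
at most the maximal cost times the total variation of the marginals. -/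
theorem exists_matrix_of_marginals {A B : Type*} [Fintype A] [Fintype B] {l : A → B → ℝ}
    {u u' : A → ℝ} {v v' : B → ℝ} (hl : ∀ a b, 0 ≤ l a b) (hlu : ∀ a, ∑ b, l a b = u a)
    (hlv : ∀ b, ∑ a, l a b = v b) (hu' : ∀ a, 0 ≤ u' a) (hv' : ∀ b, 0 ≤ v' b)
    (huu' : ∑ a, u' a = ∑ a, u a) (hvv' : ∑ b, v' b = ∑ b, v b)
    {C : A → B → ℝ} {D : ℝ} (hC : ∀ a b, 0 ≤ C a b) (hCD : ∀ a b, C a b ≤ D) (hD : 0 ≤ D) :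
    ∃ l' : A → B → ℝ, (∀ a b, 0 ≤ l' a b) ∧ (∀ a, ∑ b, l' a b = u' a) ∧
      (∀ b, ∑ a, l' a b = v' b) ∧
      ∑ a, ∑ b, l' a b * C a b ≤
        ∑ a, ∑ b, l a b * C a b + D * (∑ a, |u a - u' a| + ∑ b, |v b - v' b|) := by
  have hu : ∀ a, 0 ≤ u a := fun a => hlu a ▸ Finset.sum_nonneg fun b _ => hl a b
  have hv : ∀ b, 0 ≤ v b := fun b => hlv b ▸ Finset.sum_nonneg fun a _ => hl a b
  -- The factor that shrinks a marginal `x` to at most `y`, losing no more than `|x - y|`. For `x =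
  -- 0` it is `0`, as `y / 0 = 0`, which is harmless.
  have ratio : ∀ x y : ℝ, 0 ≤ x → 0 ≤ y →
      0 ≤ min 1 (y / x) ∧ min 1 (y / x) ≤ 1 ∧ x * min 1 (y / x) ≤ y ∧
        x * (1 - min 1 (y / x)) ≤ |x - y| := by
    intro x y hx hy
    refine ⟨le_min zero_le_one (by positivity), min_le_left _ _, ?_, ?_⟩
    · rcases hx.eq_or_lt with rfl | hx
      · simpa using hy
      · calc x * min 1 (y / x) ≤ x * (y / x) := by gcongr; exact min_le_right _ _
          _ = y := by field_simp
    · rcases hx.eq_or_lt with rfl | hx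
      · simp
      · rcases min_choice 1 (y / x) with h | h <;> rw [h]
        · simp
        · rw [mul_sub, mul_div_cancel₀ _ hx.ne', mul_one]
          exact le_abs_self _
  choose s0 s1 su sd using fun a => ratio (u a) (u' a) (hu a) (hu' a)
  choose t0 t1 tv td using fun b => ratio (v b) (v' b) (hv b) (hv' b)
  generalize hs : (fun a => min 1 (u' a / u a)) = s at *
  generalize ht : (fun b => min 1 (v' b / v b)) = t at *
  have hs' : ∀ a, min 1 (u' a / u a) = s a := fun a => congrFun hs a
  have ht' : ∀ b, min 1 (v' b / v b) = t b := fun b => congrFun ht b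
  simp only [hs'] at s0 s1 su sd
  simp only [ht'] at t0 t1 tv td
  -- After this shrinking no row or column exceeds its new marginal; only deficits remain, with the
  -- same total `δ` over rows and over columns.
  set m : A → B → ℝ := fun a b => l a b * (s a * t b) with hm
  have hm0 : ∀ a b, 0 ≤ m a b := fun a b => mul_nonneg (hl a b) (mul_nonneg (s0 a) (t0 b))
  have hml : ∀ a b, m a b ≤ l a b := fun a b =>
    mul_le_of_le_one_right (hl a b) (mul_le_one₀ (s1 a) (t0 b) (t1 b))
  have hrow : ∀ a, 0 ≤ u' a - ∑ b, m a b := by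
    intro a
    have : ∑ b, m a b ≤ u a * s a := by
      rw [← hlu, Finset.sum_mul]
      refine Finset.sum_le_sum fun b _ => mul_le_mul_of_nonneg_left ?_ (hl a b)
      exact mul_le_of_le_one_right (s0 a) (t1 b)
    linarith [su a]
  have hcol : ∀ b, 0 ≤ v' b - ∑ a, m a b := by
    intro b
    have : ∑ a, m a b ≤ v b * t b := by
      rw [← hlv, Finset.sum_mul]
      refine Finset.sum_le_sum fun a _ => mul_le_mul_of_nonneg_left ?_ (hl a b)
      exact mul_le_of_le_one_left (t0 b) (s1 a)
    linarith [tv b]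
  have huv : ∑ a, u a = ∑ b, v b := by
    simp_rw [← hlu, ← hlv]
    exact Finset.sum_comm
  set δ : ℝ := ∑ a, (u' a - ∑ b, m a b) with hδ
  have hδ' : δ = ∑ b, (v' b - ∑ a, m a b) := by
    rw [hδ, Finset.sum_sub_distrib, Finset.sum_sub_distrib, Finset.sum_comm, huu', hvv', huv]
  have hδ0 : 0 ≤ δ := Finset.sum_nonneg fun a _ => hrow a
  -- If `δ = 0`, every deficit vanishes, so division by zero does no harm.
  have hrowz : ∀ a, (u' a - ∑ b, m a b) * δ / δ = u' a - ∑ b, m a b := by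
    intro a
    by_cases h : δ = 0
    · have := (Finset.sum_eq_zero_iff_of_nonneg fun a _ => hrow a).1 (hδ ▸ h) a (Finset.mem_univ a)
      rw [this, h]; simp
    · field_simp
  have hcolz : ∀ b, δ * (v' b - ∑ a, m a b) / δ = v' b - ∑ a, m a b := by
    intro b
    by_cases h : δ = 0
    · have := (Finset.sum_eq_zero_iff_of_nonneg fun b _ => hcol b).1 (hδ' ▸ h) b
        (Finset.mem_univ b)
      rw [this, h]; simp
    · field_simp
  -- The deficits are filled by their normalised product.
  set l' : A → B → ℝ :=
    fun a b => m a b + (u' a - ∑ b, m a b) * (v' b - ∑ a, m a b) / δ with hl'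
  have hml' : ∀ a b, m a b ≤ l' a b := fun a b =>
    le_add_of_nonneg_right (div_nonneg (mul_nonneg (hrow a) (hcol b)) hδ0)
  have hl'u : ∀ a, ∑ b, l' a b = u' a := by
    intro a
    simp only [hl', Finset.sum_add_distrib]
    rw [← Finset.sum_div, ← Finset.mul_sum, ← hδ', hrowz]
    ring
  have hl'v : ∀ b, ∑ a, l' a b = v' b := by
    intro b
    simp only [hl', Finset.sum_add_distrib]
    rw [← Finset.sum_div, ← Finset.sum_mul, ← hδ, hcolz]
    ring
  refine ⟨l', fun a b => (hm0 a b).trans (hml' a b), hl'u, hl'v, ?_⟩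
  have hδle : δ ≤ ∑ a, |u a - u' a| + ∑ b, |v b - v' b| := by
    calc δ = ∑ a, ∑ b, (l a b - m a b) := by
          simp_rw [hδ, Finset.sum_sub_distrib, huu', hlu]
      _ ≤ ∑ a, ∑ b, (l a b * (1 - s a) + l a b * (1 - t b)) := by
          refine Finset.sum_le_sum fun a _ => Finset.sum_le_sum fun b _ => ?_
          -- `1 - st ≤ (1 - s) + (1 - t)`, because `(1 - s)(1 - t) ≥ 0`.
          have := mul_nonneg (hl a b) (mul_nonneg (sub_nonneg.2 (s1 a)) (sub_nonneg.2 (t1 b)))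
          simp only [hm]
          nlinarith
      _ = ∑ a, u a * (1 - s a) + ∑ b, v b * (1 - t b) := by
          simp_rw [Finset.sum_add_distrib]
          congr 1
          · simp_rw [← Finset.sum_mul, hlu]
          · rw [Finset.sum_comm]
            simp_rw [← Finset.sum_mul, hlv]
      _ ≤ _ := add_le_add (Finset.sum_le_sum fun a _ => sd a) (Finset.sum_le_sum fun b _ => td b)
  calc ∑ a, ∑ b, l' a b * C a b
      -- Only the added mass, of total `δ`, can raise the cost, at a price of at most `D` per unit.
      ≤ ∑ a, ∑ b, (l a b * C a b + D * (l' a b - m a b)) := by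
        refine Finset.sum_le_sum fun a _ => Finset.sum_le_sum fun b _ => ?_
        have h1 := mul_le_mul_of_nonneg_right (hml a b) (hC a b)
        have h2 := mul_le_mul_of_nonneg_left (hCD a b) (sub_nonneg.2 (hml' a b))
        linarith
    _ = ∑ a, ∑ b, l a b * C a b + D * δ := by
        simp_rw [Finset.sum_add_distrib, ← Finset.mul_sum, Finset.sum_sub_distrib, hl'u, hδ,
          Finset.sum_sub_distrib]
    _ ≤ _ := by gcongr

/-! ### Discretization of plans -/

section Labels

set_option linter.unusedSectionVars false

variable {Ω Ω' A B : Type*} [MeasurableSpace Ω] [MeasurableSpace Ω']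
  [Fintype A] [MeasurableSpace A] [MeasurableSingletonClass A]
  [Fintype B] [MeasurableSpace B] [MeasurableSingletonClass B]

theorem IsPlan.isProbabilityMeasure {P : Measure Ω} {Q : Measure Ω'} [IsProbabilityMeasure P]
    {L : Measure (Ω × Ω')} (hL : IsPlan P Q L) : IsProbabilityMeasure L := by
  constructor
  have := congrArg (fun ν => ν Set.univ) hL.1
  simpa [Measure.map_apply measurable_fst MeasurableSet.univ] using this

theorem isPlan_prod (P : Measure Ω) (Q : Measure Ω') [IsProbabilityMeasure P]
    [IsProbabilityMeasure Q] : IsPlan P Q (P.prod Q) := by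
  constructor
  · simp [Measure.map_fst_prod]
  · simp [Measure.map_snd_prod]

theorem sum_measureReal_inter_preimage (P : Measure Ω) [IsFiniteMeasure P] {α : Ω → A}
    (hα : Measurable α) {s : Set Ω} (hs : MeasurableSet s) :
    ∑ a, P.real (s ∩ α ⁻¹' {a}) = P.real s := by
  have h : s = ⋃ a ∈ (Finset.univ : Finset A), s ∩ α ⁻¹' {a} := by ext; simp
  conv_rhs => rw [h]
  rw [measureReal_biUnion_finset]
  · intro a _ b _ hab
    refine Set.disjoint_left.2 fun x hx hx' => hab ?_
    rw [← hx.2, ← hx'.2]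
  · exact fun a _ => hs.inter (hα (measurableSet_singleton a))

theorem sum_measureReal_preimage (P : Measure Ω) [IsProbabilityMeasure P] {α : Ω → A}
    (hα : Measurable α) : ∑ a, P.real (α ⁻¹' {a}) = 1 := by
  simpa using sum_measureReal_inter_preimage P hα MeasurableSet.univ

theorem IsPlan.sum_row {P : Measure Ω} {Q : Measure Ω'} [IsProbabilityMeasure P]
    {L : Measure (Ω × Ω')} (hL : IsPlan P Q L) {α : Ω → A} {β : Ω' → B} (hα : Measurable α)
    (hβ : Measurable β) (a : A) :
    ∑ b, L.real ((α ⁻¹' {a}) ×ˢ (β ⁻¹' {b})) = P.real (α ⁻¹' {a}) := by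
  have := hL.isProbabilityMeasure
  rw [← hL.1, map_measureReal_apply measurable_fst (hα (measurableSet_singleton a)),
    ← sum_measureReal_inter_preimage L (hβ.comp measurable_snd)
      (measurable_fst (hα (measurableSet_singleton a)))]
  rfl

theorem IsPlan.sum_col {P : Measure Ω} {Q : Measure Ω'} [IsProbabilityMeasure P]
    {L : Measure (Ω × Ω')} (hL : IsPlan P Q L) {α : Ω → A} {β : Ω' → B} (hα : Measurable α)
    (hβ : Measurable β) (b : B) :
    ∑ a, L.real ((α ⁻¹' {a}) ×ˢ (β ⁻¹' {b})) = Q.real (β ⁻¹' {b}) := by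
  have := hL.isProbabilityMeasure
  rw [← hL.2, map_measureReal_apply measurable_snd (hβ (measurableSet_singleton b)),
    ← sum_measureReal_inter_preimage L (hα.comp measurable_fst)
      (measurable_snd (hβ (measurableSet_singleton b)))]
  refine Finset.sum_congr rfl fun a _ => congrArg _ ?_
  ext; simp [and_comm]

/-- The cost of a plan is close to the cost of its discretization. -/
theorem abs_integral_sub_sum_le (L : Measure (Ω × Ω')) [IsProbabilityMeasure L] {α : Ω → A}
    {β : Ω' → B} (hα : Measurable α) (hβ : Measurable β) {c : Ω → Ω' → ℝ}
    (hc : Measurable fun p : Ω × Ω' => c p.1 p.2) {C : A → B → ℝ} {ε : ℝ}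
    (hcC : ∀ x y, |c x y - C (α x) (β y)| ≤ ε) :
    |∫ p, c p.1 p.2 ∂L - ∑ a, ∑ b, L.real ((α ⁻¹' {a}) ×ˢ (β ⁻¹' {b})) * C a b| ≤ ε := by
  have hαβ : Measurable (Prod.map α β) := hα.prodMap hβ
  have hCm : Measurable fun q : A × B => C q.1 q.2 := measurable_of_finite _
  have hCi : Integrable (fun q : A × B => C q.1 q.2) (L.map (Prod.map α β)) := by
    have : IsProbabilityMeasure (L.map (Prod.map α β)) :=
      Measure.isProbabilityMeasure_map hαβ.aemeasurable
    exact .of_finite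
  have hCi' : Integrable (fun p : Ω × Ω' => C (α p.1) (β p.2)) L :=
    hCi.comp_measurable hαβ
  -- Integrability of `c` comes from its bounded distance to a function with finitely many values.
  have hdiff : Integrable (fun p : Ω × Ω' => c p.1 p.2 - C (α p.1) (β p.2)) L :=
    Integrable.of_bound (hc.sub (hCm.comp hαβ)).aestronglyMeasurable ε
      (Eventually.of_forall fun p => hcC p.1 p.2)
  have hci : Integrable (fun p : Ω × Ω' => c p.1 p.2) L := by
    refine (hdiff.add hCi').congr (Eventually.of_forall fun p => ?_)
    simp
  have hsum : ∫ p, C (α p.1) (β p.2) ∂L =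
      ∑ a, ∑ b, L.real ((α ⁻¹' {a}) ×ˢ (β ⁻¹' {b})) * C a b := by
    have h := integral_map hαβ.aemeasurable (μ := L) hCm.aestronglyMeasurable
    simp only [Prod.map_fst, Prod.map_snd] at h
    rw [← h, integral_fintype hCi, Fintype.sum_prod_type]
    refine Finset.sum_congr rfl fun a _ => Finset.sum_congr rfl fun b _ => ?_
    rw [map_measureReal_apply hαβ (measurableSet_singleton _), smul_eq_mul,
      ← Set.singleton_prod_singleton]
    rfl
  rw [← hsum, ← integral_sub hci hCi']
  have := norm_integral_le_of_norm_le_const (μ := L) (C := ε)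
    (f := fun p : Ω × Ω' => c p.1 p.2 - C (α p.1) (β p.2))
    (Eventually.of_forall fun p => hcC p.1 p.2)
  simpa using this

theorem lintegral_comp_label (Q : Measure Ω') {β : Ω' → B} (hβ : Measurable β)
    (h : B → ENNReal) : ∫⁻ y, h (β y) ∂Q = ∑ b, h b * Q (β ⁻¹' {b}) := by
  rw [← lintegral_map (measurable_of_finite h) hβ, lintegral_fintype]
  exact Finset.sum_congr rfl fun b _ => by
    rw [Measure.map_apply hβ (measurableSet_singleton b)]

theorem ae_measure_preimage_label_ne_zero (P : Measure Ω) (α : Ω → A) :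
    ∀ᵐ x ∂P, P (α ⁻¹' {α x}) ≠ 0 := by
  have : ∀ᵐ x ∂P, ∀ a, P (α ⁻¹' {a}) = 0 → α x ≠ a := by
    refine ae_all_iff.2 fun a => ?_
    by_cases h : P (α ⁻¹' {a}) = 0
    · have : ∀ᵐ x ∂P, x ∉ α ⁻¹' {a} := measure_eq_zero_iff_ae_notMem.1 h
      filter_upwards [this] with x hx _ using hx
    · exact Eventually.of_forall fun x hx => absurd hx h
  filter_upwards [this] with x hx h using hx _ h rfl

/-- Every transportation matrix between the label distributions comes from a plan. -/
theorem exists_isPlan_of_matrix (P : Measure Ω) (Q : Measure Ω') [IsProbabilityMeasure P]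
    [IsProbabilityMeasure Q] {α : Ω → A} {β : Ω' → B} (hα : Measurable α) (hβ : Measurable β)
    {l : A → B → ℝ} (hl : ∀ a b, 0 ≤ l a b) (hlu : ∀ a, ∑ b, l a b = P.real (α ⁻¹' {a}))
    (hlv : ∀ b, ∑ a, l a b = Q.real (β ⁻¹' {b})) :
    ∃ L : Measure (Ω × Ω'), IsPlan P Q L ∧
      ∀ a b, L.real ((α ⁻¹' {a}) ×ˢ (β ⁻¹' {b})) = l a b := by
  set u : A → ℝ := fun a => P.real (α ⁻¹' {a}) with hu
  set v : B → ℝ := fun b => Q.real (β ⁻¹' {b}) with hv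
  have hPu : ∀ a, P (α ⁻¹' {a}) = ENNReal.ofReal (u a) := fun a => by simp [hu]
  have hQv : ∀ b, Q (β ⁻¹' {b}) = ENNReal.ofReal (v b) := fun b => by simp [hv]
  have hu0 : ∀ a, 0 ≤ u a := fun a => measureReal_nonneg
  have hv0 : ∀ b, 0 ≤ v b := fun b => measureReal_nonneg
  have hlu0 : ∀ a b, u a = 0 → l a b = 0 := fun a b h =>
    (Finset.sum_eq_zero_iff_of_nonneg fun b _ => hl a b).1 ((hlu a).trans h) b (Finset.mem_univ b)
  have hlv0 : ∀ a b, v b = 0 → l a b = 0 := fun a b h =>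
    (Finset.sum_eq_zero_iff_of_nonneg fun a _ => hl a b).1 ((hlv b).trans h) a (Finset.mem_univ a)
  -- On each cell the plan is the product measure rescaled to mass `l a b`. Where the denominator
  -- vanishes, so does `l a b`.
  set g : A → B → ENNReal := fun a b => ENNReal.ofReal (l a b / (u a * v b)) with hg
  have hgv : ∀ a b, g a b * Q (β ⁻¹' {b}) = ENNReal.ofReal (l a b / u a) := by
    intro a b
    rw [hQv, hg, ← ENNReal.ofReal_mul (div_nonneg (hl a b) (mul_nonneg (hu0 a) (hv0 b)))]
    by_cases h : v b = 0
    · simp [h, hlv0 a b h]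
    · congr 1; field_simp
  have hgu : ∀ a b, g a b * P (α ⁻¹' {a}) = ENNReal.ofReal (l a b / v b) := by
    intro a b
    rw [hPu, hg, ← ENNReal.ofReal_mul (div_nonneg (hl a b) (mul_nonneg (hu0 a) (hv0 b)))]
    by_cases h : u a = 0
    · simp [h, hlu0 a b h]
    · congr 1; field_simp
  have hgm : Measurable fun p : Ω × Ω' => g (α p.1) (β p.2) :=
    (measurable_of_finite fun q : A × B => g q.1 q.2).comp (hα.prodMap hβ)
  refine ⟨(P.prod Q).withDensity fun p => g (α p.1) (β p.2), ⟨?_, ?_⟩, ?_⟩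
  · ext s hs
    rw [Measure.map_apply measurable_fst hs, withDensity_apply _ (measurable_fst hs),
      ← Set.prod_univ, ← Measure.prod_restrict, Measure.restrict_univ,
      lintegral_prod _ hgm.aemeasurable]
    calc _ = ∫⁻ x in s, 1 ∂P := by
          refine lintegral_congr_ae (ae_restrict_of_ae ?_)
          filter_upwards [ae_measure_preimage_label_ne_zero P α] with x hx
          have hx' : u (α x) ≠ 0 := fun h => hx (by rw [hPu, h]; simp)
          rw [lintegral_comp_label Q hβ (g (α x))]
          simp_rw [hgv]
          rw [← ENNReal.ofReal_sum_of_nonneg fun b _ => div_nonneg (hl _ b) (hu0 _),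
            ← Finset.sum_div, hlu, div_self hx', ENNReal.ofReal_one]
      _ = P s := by simp
  · ext s hs
    rw [Measure.map_apply measurable_snd hs, withDensity_apply _ (measurable_snd hs),
      ← Set.univ_prod, ← Measure.prod_restrict, Measure.restrict_univ,
      lintegral_prod_symm _ hgm.aemeasurable]
    calc _ = ∫⁻ y in s, 1 ∂Q := by
          refine lintegral_congr_ae (ae_restrict_of_ae ?_)
          filter_upwards [ae_measure_preimage_label_ne_zero Q β] with y hy
          have hy' : v (β y) ≠ 0 := fun h => hy (by rw [hQv, h]; simp)
          rw [lintegral_comp_label P hα fun a => g a (β y)]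
          simp_rw [hgu]
          rw [← ENNReal.ofReal_sum_of_nonneg fun a _ => div_nonneg (hl a _) (hv0 _),
            ← Finset.sum_div, hlv, div_self hy', ENNReal.ofReal_one]
      _ = Q s := by simp
  · intro a b
    have hms : MeasurableSet ((α ⁻¹' {a}) ×ˢ (β ⁻¹' {b})) :=
      (hα (measurableSet_singleton a)).prod (hβ (measurableSet_singleton b))
    rw [measureReal_def, withDensity_apply _ hms,
      setLIntegral_congr_fun (g := fun _ => g a b) hms (by
        rintro ⟨x, y⟩ ⟨hx, hy⟩
        simp only [Set.mem_preimage, Set.mem_singleton_iff] at hx hy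
        simp only [hx, hy]),
      setLIntegral_const, Measure.prod_prod, mul_comm (P _), ← mul_assoc, hgv, hPu,
      ← ENNReal.ofReal_mul (div_nonneg (hl a b) (hu0 a))]
    by_cases h : u a = 0
    · simp [h, hlu0 a b h]
    · rw [div_mul_cancel₀ _ h, ENNReal.toReal_ofReal (hl a b)]

end Labels

/-! ### Comparison of two Monge-Kantorovich problems -/

theorem bddBelow_planCosts {X Y : Type*} [MeasurableSpace X] [MeasurableSpace Y]
    {c : X → Y → ℝ} (hc : ∀ x y, 0 ≤ c x y) (μ : Measure X) (ν : Measure Y) :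
    BddBelow {v : ℝ | ∃ L : Measure (X × Y), IsPlan μ ν L ∧ v = ∫ p, c p.1 p.2 ∂L} := by
  refine ⟨0, ?_⟩
  rintro v ⟨L, -, rfl⟩
  exact integral_nonneg fun p => hc _ _

/-- Two problems whose costs are close to the same function of finitely many labels have values
that differ at most by the distance between the distributions of the labels. -/
theorem mkValue_le_of_labels {Ω₁ Ω₂ Ω₁' Ω₂' A B : Type*} [MeasurableSpace Ω₁] [MeasurableSpace Ω₂]
    [MeasurableSpace Ω₁'] [MeasurableSpace Ω₂']
    [Fintype A] [MeasurableSpace A] [MeasurableSingletonClass A]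
    [Fintype B] [MeasurableSpace B] [MeasurableSingletonClass B]
    (P : Measure Ω₁) (Q : Measure Ω₂) (P' : Measure Ω₁') (Q' : Measure Ω₂')
    [IsProbabilityMeasure P] [IsProbabilityMeasure Q] [IsProbabilityMeasure P']
    [IsProbabilityMeasure Q']
    {α : Ω₁ → A} {β : Ω₂ → B} {α' : Ω₁' → A} {β' : Ω₂' → B}
    (hα : Measurable α) (hβ : Measurable β) (hα' : Measurable α') (hβ' : Measurable β')
    {c : Ω₁ → Ω₂ → ℝ} (hc : Measurable fun p : Ω₁ × Ω₂ => c p.1 p.2)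
    {c' : Ω₁' → Ω₂' → ℝ} (hc' : Measurable fun p : Ω₁' × Ω₂' => c' p.1 p.2)
    (hc'0 : ∀ x y, 0 ≤ c' x y)
    {C : A → B → ℝ} {D ε : ℝ} (hC : ∀ a b, 0 ≤ C a b) (hCD : ∀ a b, C a b ≤ D) (hD : 0 ≤ D)
    (hcC : ∀ x y, |c x y - C (α x) (β y)| ≤ ε)
    (hcC' : ∀ x y, |c' x y - C (α' x) (β' y)| ≤ ε) :
    mkValue c' P' Q' ≤ mkValue c P Q + (2 * ε +
      D * (∑ a, |P.real (α ⁻¹' {a}) - P'.real (α' ⁻¹' {a})| +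
        ∑ b, |Q.real (β ⁻¹' {b}) - Q'.real (β' ⁻¹' {b})|)) := by
  rw [← sub_le_iff_le_add]
  refine le_csInf ⟨_, P.prod Q, isPlan_prod P Q, rfl⟩ ?_
  rintro v ⟨L, hL, rfl⟩
  have := hL.isProbabilityMeasure
  -- A plan for the first problem is discretized (error `ε`), its marginals are corrected, and the
  -- matrix is lifted to a plan for the second (error `ε`).
  obtain ⟨l', hl'0, hl'u, hl'v, hl'C⟩ := exists_matrix_of_marginals
    (l := fun a b => L.real ((α ⁻¹' {a}) ×ˢ (β ⁻¹' {b})))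
    (u' := fun a => P'.real (α' ⁻¹' {a})) (v' := fun b => Q'.real (β' ⁻¹' {b}))
    (fun a b => measureReal_nonneg) (hL.sum_row hα hβ) (hL.sum_col hα hβ)
    (fun a => measureReal_nonneg) (fun b => measureReal_nonneg)
    (by rw [sum_measureReal_preimage P hα, sum_measureReal_preimage P' hα'])
    (by rw [sum_measureReal_preimage Q hβ, sum_measureReal_preimage Q' hβ']) hC hCD hD
  obtain ⟨L', hL', hL'l⟩ := exists_isPlan_of_matrix P' Q' hα' hβ' hl'0 hl'u hl'v
  have := hL'.isProbabilityMeasure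
  have h1 := abs_le.1 (abs_integral_sub_sum_le L hα hβ hc hcC)
  have h2 := abs_le.1 (abs_integral_sub_sum_le L' hα' hβ' hc' hcC')
  simp only [hL'l] at h2
  have h3 : mkValue c' P' Q' ≤ ∫ p, c' p.1 p.2 ∂L' :=
    csInf_le (bddBelow_planCosts hc'0 P' Q') ⟨L', hL', rfl⟩
  linarith [h1.1, h2.2]

theorem abs_mkValue_sub_le_of_labels {Ω₁ Ω₂ Ω₁' Ω₂' A B : Type*} [MeasurableSpace Ω₁]
    [MeasurableSpace Ω₂] [MeasurableSpace Ω₁'] [MeasurableSpace Ω₂']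
    [Fintype A] [MeasurableSpace A] [MeasurableSingletonClass A]
    [Fintype B] [MeasurableSpace B] [MeasurableSingletonClass B]
    (P : Measure Ω₁) (Q : Measure Ω₂) (P' : Measure Ω₁') (Q' : Measure Ω₂')
    [IsProbabilityMeasure P] [IsProbabilityMeasure Q] [IsProbabilityMeasure P']
    [IsProbabilityMeasure Q']
    {α : Ω₁ → A} {β : Ω₂ → B} {α' : Ω₁' → A} {β' : Ω₂' → B}
    (hα : Measurable α) (hβ : Measurable β) (hα' : Measurable α') (hβ' : Measurable β')
    {c : Ω₁ → Ω₂ → ℝ} (hc : Measurable fun p : Ω₁ × Ω₂ => c p.1 p.2)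
    {c' : Ω₁' → Ω₂' → ℝ} (hc' : Measurable fun p : Ω₁' × Ω₂' => c' p.1 p.2)
    (hc0 : ∀ x y, 0 ≤ c x y) (hc'0 : ∀ x y, 0 ≤ c' x y)
    {C : A → B → ℝ} {D ε : ℝ} (hC : ∀ a b, 0 ≤ C a b) (hCD : ∀ a b, C a b ≤ D) (hD : 0 ≤ D)
    (hcC : ∀ x y, |c x y - C (α x) (β y)| ≤ ε)
    (hcC' : ∀ x y, |c' x y - C (α' x) (β' y)| ≤ ε) :
    |mkValue c' P' Q' - mkValue c P Q| ≤ 2 * ε +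
      D * (∑ a, |P'.real (α' ⁻¹' {a}) - P.real (α ⁻¹' {a})| +
        ∑ b, |Q'.real (β' ⁻¹' {b}) - Q.real (β ⁻¹' {b})|) := by
  have h1 := mkValue_le_of_labels P Q P' Q' hα hβ hα' hβ' hc hc' hc'0 hC hCD hD hcC hcC'
  have h2 := mkValue_le_of_labels P' Q' P Q hα' hβ' hα hβ hc' hc hc0 hC hCD hD hcC' hcC
  simp_rw [abs_sub_comm (P.real _), abs_sub_comm (Q.real _)] at h1
  exact abs_sub_le_iff.2 ⟨by linarith, by linarith⟩

/-- A measure-preserving map of the second space carries plans to plans. -/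
theorem IsPlan.map_second {X Y Z : Type*} [MeasurableSpace X] [MeasurableSpace Y]
    [MeasurableSpace Z] {μ : Measure X} {ν : Measure Y} {ν' : Measure Z} {R : Y → Z}
    {L : Measure (X × Y)} (hL : IsPlan μ ν L) (hR : MeasurePreserving R ν ν') :
    IsPlan μ ν' (L.map (Prod.map id R)) := by
  have hm : Measurable (Prod.map id R : X × Y → X × Z) := measurable_id.prodMap hR.measurable
  constructor
  · rw [Measure.map_map measurable_fst hm, ← hL.1]; rfl
  · rw [Measure.map_map measurable_snd hm, ← hR.map_eq, ← hL.2,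
      Measure.map_map hR.measurable measurable_snd]; rfl

/-- The value is unchanged when the second space is transformed by an isomorphism. -/
theorem mkValue_comp_isomorphism {X Y Z : Type*} [MeasurableSpace X] [MeasurableSpace Y]
    [MeasurableSpace Z] {μ : Measure X} {ν : Measure Y} {ν' : Measure Z} {S : Y → Z}
    (hS : IsIsomorphismModZero ν ν' S) {c : X → Z → ℝ}
    (hc : Measurable fun p : X × Z => c p.1 p.2) :
    mkValue (fun x y => c x (S y)) μ ν = mkValue c μ ν' := by
  obtain ⟨hS, T, hT, -, hST⟩ := hS
  unfold mkValue
  congr 1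
  ext v
  constructor
  · rintro ⟨L, hL, rfl⟩
    refine ⟨_, hL.map_second hS, ?_⟩
    rw [integral_map (measurable_id.prodMap hS.measurable).aemeasurable hc.aestronglyMeasurable]
    rfl
  · rintro ⟨L, hL, rfl⟩
    refine ⟨_, hL.map_second hT, ?_⟩
    have hcS : Measurable fun p : X × Y => c p.1 (S p.2) :=
      hc.comp (measurable_id.prodMap hS.measurable)
    rw [integral_map (measurable_id.prodMap hT.measurable).aemeasurable
      hcS.aestronglyMeasurable]
    refine integral_congr_ae ?_
    -- The exceptional set is null for the second marginal of `L`, hence its preimage is null for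
    -- `L`.
    have h : ∀ᵐ p ∂L, S (T p.2) = p.2 :=
      ae_of_ae_map measurable_snd.aemeasurable (hL.2.symm ▸ hST)
    filter_upwards [h] with p hp
    simp [hp]

/-! ### The assignment problem -/

/-- By Birkhoff's theorem the value of an assignment problem is attained at permutations. -/
theorem assignmentValue_eq_iInf_perm (n : ℕ) (r : ℕ → ℕ → ℝ) :
    assignmentValue n r =
      (n : ℝ)⁻¹ * ⨅ σ : Equiv.Perm (Fin n), ∑ i : Fin n, r i (σ i) := by
  have hperm : ∀ σ : Equiv.Perm (Fin n),
      ∑ i : Fin n, ∑ j : Fin n, σ.permMatrix ℝ i j * r i j = ∑ i : Fin n, r i (σ i) := by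
    intro σ
    refine Finset.sum_congr rfl fun i _ => ?_
    simp [PEquiv.toMatrix_apply]
  have hle : ∀ l ∈ doublyStochastic ℝ (Fin n),
      ⨅ σ : Equiv.Perm (Fin n), ∑ i : Fin n, r i (σ i) ≤
        ∑ i : Fin n, ∑ j : Fin n, l i j * r i j := by
    intro l hl
    obtain ⟨w, hw0, hw1, rfl⟩ := exists_eq_sum_perm_of_mem_doublyStochastic hl
    calc (⨅ σ : Equiv.Perm (Fin n), ∑ i : Fin n, r i (σ i))
        = ∑ τ, w τ * ⨅ σ : Equiv.Perm (Fin n), ∑ i : Fin n, r i (σ i) := by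
          rw [← Finset.sum_mul, hw1, one_mul]
      _ ≤ ∑ τ, w τ * ∑ i : Fin n, ∑ j : Fin n, τ.permMatrix ℝ i j * r i j := by
          refine Finset.sum_le_sum fun τ _ => mul_le_mul_of_nonneg_left ?_ (hw0 τ)
          rw [hperm]
          exact ciInf_le (Set.finite_range _).bddBelow τ
      _ = _ := by
          simp_rw [Matrix.sum_apply, Matrix.smul_apply, smul_eq_mul, Finset.sum_mul,
            Finset.mul_sum]
          rw [Finset.sum_comm]
          refine Finset.sum_congr rfl fun i _ => ?_
          rw [Finset.sum_comm]
          simp_rw [mul_assoc]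
  unfold assignmentValue
  congr 1
  refine le_antisymm (le_ciInf fun σ => ?_) (le_csInf ⟨_, 1, one_mem _, rfl⟩ ?_)
  · refine csInf_le ⟨⨅ σ : Equiv.Perm (Fin n), ∑ i : Fin n, r i (σ i), ?_⟩
      ⟨σ.permMatrix ℝ, permMatrix_mem_doublyStochastic, (hperm σ).symm⟩
    rintro v ⟨l, hl, rfl⟩
    exact hle l hl
  · rintro v ⟨l, hl, rfl⟩
    exact hle l hl

/-- Passing to permutations replaces an uncountable infimum by a finite one. -/
theorem measurable_assignmentValue (n : ℕ) : Measurable (assignmentValue n) := by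
  have : assignmentValue n = fun r => (n : ℝ)⁻¹ *
      ⨅ σ : Equiv.Perm (Fin n), ∑ i : Fin n, r i (σ i) :=
    funext (assignmentValue_eq_iInf_perm n)
  rw [this]
  refine Measurable.const_mul (Measurable.iInf fun σ => ?_) _
  fun_prop

open ProbabilityTheory in
theorem measureReal_uniformOn_univ_fin (n : ℕ) (s : Set (Fin n)) [DecidablePred (· ∈ s)] :
    (uniformOn (Set.univ : Set (Fin n))).real s = (∑ i : Fin n, if i ∈ s then 1 else 0) / n := by
  rw [measureReal_def, uniformOn_univ, ENNReal.toReal_div]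
  congr 1
  · have h : s = ((Finset.univ.filter (· ∈ s) : Finset (Fin n)) : Set (Fin n)) := by simp
    conv_lhs => rw [h]
    rw [Measure.count_apply_finset]
    simp
  · simp

open ProbabilityTheory in
/-- The assignment problem is the Monge-Kantorovich problem for uniform measures. -/
theorem assignmentValue_eq_mkValue_uniformOn {n : ℕ} [NeZero n] (r : ℕ → ℕ → ℝ) :
    assignmentValue n r = mkValue (fun i j : Fin n => r i j) (uniformOn Set.univ)
      (uniformOn Set.univ) := by
  have hn : (n : ℝ) ≠ 0 := NeZero.ne _
  have hn0 : (0 : ℝ) ≤ (n : ℝ)⁻¹ := by positivity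
  have hu : ∀ i : Fin n, (uniformOn (Set.univ : Set (Fin n))).real (id ⁻¹' {i}) = (n : ℝ)⁻¹ := by
    intro i
    rw [Set.preimage_id, measureReal_uniformOn_univ_fin]
    simp
  have hint : ∀ L : Measure (Fin n × Fin n), IsProbabilityMeasure L →
      ∫ p : Fin n × Fin n, r p.1 p.2 ∂L =
        ∑ i : Fin n, ∑ j : Fin n, L.real ((id ⁻¹' {i}) ×ˢ (id ⁻¹' {j})) * r i j := by
    intro L _
    -- Each point is its own label, so the discretization error is `0`.
    refine sub_eq_zero.1 (abs_nonpos_iff.1 (abs_integral_sub_sum_le L measurable_id measurable_id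
      (c := fun i j : Fin n => r i j) (C := fun i j : Fin n => r i j) (measurable_of_finite _)
      (by simp)))
  unfold assignmentValue mkValue
  rw [← smul_eq_mul, ← Real.sInf_smul_of_nonneg hn0]
  congr 1
  ext v
  rw [Set.mem_smul_set]
  constructor
  · rintro ⟨_, ⟨l, hl, rfl⟩, rfl⟩
    rw [mem_doublyStochastic_iff_sum] at hl
    obtain ⟨L, hL, hLl⟩ := exists_isPlan_of_matrix (uniformOn (Set.univ : Set (Fin n)))
      (uniformOn (Set.univ : Set (Fin n))) measurable_id measurable_id
      (l := fun i j => (n : ℝ)⁻¹ * l i j) (fun i j => mul_nonneg hn0 (hl.1 i j))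
      (fun i => by rw [hu, ← Finset.mul_sum, hl.2.1, mul_one])
      (fun j => by rw [hu, ← Finset.mul_sum, hl.2.2, mul_one])
    refine ⟨L, hL, ?_⟩
    rw [hint L hL.isProbabilityMeasure]
    simp_rw [hLl, smul_eq_mul, Finset.mul_sum, mul_assoc]
  · rintro ⟨L, hL, rfl⟩
    refine ⟨_, ⟨Matrix.of fun i j => n * L.real ((id ⁻¹' {i}) ×ˢ (id ⁻¹' {j})), ?_, rfl⟩, ?_⟩
    · rw [mem_doublyStochastic_iff_sum]
      simp only [Matrix.of_apply]
      refine ⟨fun i j => by positivity, fun i => ?_, fun j => ?_⟩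
      · rw [← Finset.mul_sum, hL.sum_row measurable_id measurable_id, hu, mul_inv_cancel₀ hn]
      · rw [← Finset.mul_sum, hL.sum_col measurable_id measurable_id, hu, mul_inv_cancel₀ hn]
    · rw [hint L hL.isProbabilityMeasure]
      simp_rw [Matrix.of_apply, smul_eq_mul, Finset.mul_sum, ← mul_assoc,
        inv_mul_cancel₀ hn, one_mul]

/-! ### Sampling -/

/-- A compact metric space has arbitrarily fine measurable maps to finite sets of its points. -/
theorem exists_measurable_label (X : Type*) [MetricSpace X] [CompactSpace X] [Nonempty X]
    [MeasurableSpace X] [BorelSpace X] {ε : ℝ} (hε : 0 < ε) :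
    ∃ (m : ℕ) (α : X → Fin m) (p : Fin m → X), Measurable α ∧ ∀ x, dist x (p (α x)) ≤ ε := by
  set e := TopologicalSpace.denseSeq X
  have hcover : (Set.univ : Set X) ⊆ ⋃ k, Metric.ball (e k) ε := by
    intro x _
    obtain ⟨k, hk⟩ := (TopologicalSpace.denseRange_denseSeq X).exists_dist_lt x hε
    exact Set.mem_iUnion.2 ⟨k, hk⟩
  obtain ⟨t, ht⟩ := isCompact_univ.elim_finite_subcover _ (fun k => Metric.isOpen_ball) hcover
  set N := t.sup id
  -- The label is the index of a nearest point among `e 0, …, e N`; it is at most `N`, so reduction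
  -- mod `N + 1` changes nothing.
  refine ⟨N + 1, fun x => Fin.ofNat (N + 1) (SimpleFunc.nearestPtInd e N x),
    fun i => e i, ?_, fun x => ?_⟩
  · exact (measurable_of_countable (Fin.ofNat (N + 1))).comp (SimpleFunc.nearestPtInd e N).measurable
  · obtain ⟨k, hkt, hk⟩ := Set.mem_iUnion₂.1 (ht (Set.mem_univ x))
    have hkN : k ≤ N := Finset.le_sup (f := id) hkt
    have h := SimpleFunc.edist_nearestPt_le e x hkN
    rw [edist_dist, edist_dist, ENNReal.ofReal_le_ofReal_iff dist_nonneg] at h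
    simp only [Fin.val_ofNat]
    rw [Nat.mod_eq_of_lt (Nat.lt_succ_of_le (SimpleFunc.nearestPtInd_le e N x)),
      dist_comm]
    rw [Metric.mem_ball, dist_comm] at hk
    exact h.trans hk.le

/-- The frequency of an event in an infinite sample converges to its probability. -/
theorem tendsto_frequency {X : Type*} [MeasurableSpace X] (μ : Measure X)
    [IsProbabilityMeasure μ] {s : Set X} (hs : MeasurableSet s) [DecidablePred (· ∈ s)] :
    ∀ᵐ x ∂(Measure.infinitePi fun _ : ℕ => μ),
      Tendsto (fun n : ℕ => (∑ i : Fin n, if x i ∈ s then (1 : ℝ) else 0) / n) atTop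
        (nhds (μ.real s)) := by
  have hm : Measurable fun y : X => if y ∈ s then (1 : ℝ) else 0 :=
    Measurable.ite hs measurable_const measurable_const
  have hmi : ∀ i : ℕ, Measurable fun x : ℕ → X => if x i ∈ s then (1 : ℝ) else 0 :=
    fun i => hm.comp (measurable_pi_apply i)
  have hmp : ∀ i : ℕ, MeasurePreserving (fun x : ℕ → X => x i)
      (Measure.infinitePi fun _ : ℕ => μ) μ := fun i =>
    measurePreserving_eval_infinitePi (fun _ : ℕ => μ) i
  have hident : ∀ i : ℕ, (Measure.infinitePi fun _ : ℕ => μ).map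
      (fun x : ℕ → X => if x i ∈ s then (1 : ℝ) else 0) =
        μ.map fun y => if y ∈ s then (1 : ℝ) else 0 := by
    intro i
    conv_rhs => rw [← (hmp i).map_eq, Measure.map_map hm (measurable_pi_apply i)]
    rfl
  have hlaw := ProbabilityTheory.strong_law_ae_real
    (μ := Measure.infinitePi fun _ : ℕ => μ)
    (fun i x => if x i ∈ s then (1 : ℝ) else 0)
    (Integrable.of_bound (hmi 0).aestronglyMeasurable 1
      (Eventually.of_forall fun x => by split_ifs <;> simp))
    (fun i j hij => (ProbabilityTheory.iIndepFun_infinitePi (P := fun _ : ℕ => μ)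
      (X := fun _ y => if y ∈ s then (1 : ℝ) else 0) fun _ => hm).indepFun hij)
    (fun i => ⟨(hmi i).aemeasurable, (hmi 0).aemeasurable, by rw [hident i, hident 0]⟩)
  have hmean : ∫ x, (if x 0 ∈ s then (1 : ℝ) else 0) ∂(Measure.infinitePi fun _ : ℕ => μ) =
      μ.real s := by
    have h := integral_map (hmp 0).measurable.aemeasurable
      (μ := Measure.infinitePi fun _ : ℕ => μ) hm.aestronglyMeasurable
    rw [← h, (hmp 0).map_eq, ← integral_indicator_one hs]
    refine integral_congr_ae (Eventually.of_forall fun y => ?_)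
    simp [Set.indicator_apply]
  rw [hmean] at hlaw
  filter_upwards [hlaw] with x hx
  simpa only [Finset.sum_range] using hx

open ProbabilityTheory in
/-- Almost surely, the values of the sampled assignment problems converge to the value of the
Monge-Kantorovich problem for the shifted metric. -/
theorem tendsto_assignmentValue_ae {X : Type*} [MetricSpace X] [CompactSpace X]
    [MeasurableSpace X] [BorelSpace X] (μ : Measure X) [IsProbabilityMeasure μ] {S : X → X}
    (hS : Measurable S) :
    ∀ᵐ x ∂(Measure.infinitePi fun _ : ℕ => μ),
      Tendsto (fun n : ℕ => assignmentValue n fun i j => shiftedMetric S (x i) (x j)) atTop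
        (nhds (mkValue (shiftedMetric S) μ μ)) := by
  classical
  have : Nonempty X := nonempty_of_isProbabilityMeasure μ
  have hf : Measurable fun p : X × X => shiftedMetric S p.1 p.2 :=
    measurable_fst.dist (hS.comp measurable_snd)
  -- Labels depend on the accuracy, so it runs over a countable set to keep the union of exceptional
  -- sets null. The constant `5` leaves room above the limit `4ε` of the error bound `E`.
  have key : ∀ k : ℕ, ∀ᵐ x ∂(Measure.infinitePi fun _ : ℕ => μ), ∀ᶠ n : ℕ in atTop,
      |(assignmentValue n fun i j => shiftedMetric S (x i) (x j)) -
        mkValue (shiftedMetric S) μ μ| < 5 * (1 / ((k : ℝ) + 1)) := by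
    intro k
    set ε : ℝ := 1 / ((k : ℝ) + 1)
    have hε : 0 < ε := by positivity
    obtain ⟨m, α, p, hα, hp⟩ := exists_measurable_label X hε
    have hαS : Measurable fun x => α (S x) := hα.comp hS
    -- Each of `x` and `S y` is moved by at most `ε`.
    have hcC : ∀ x y, |shiftedMetric S x y - dist (p (α x)) (p (α (S y)))| ≤ 2 * ε := by
      intro x y
      have := dist_dist_dist_le x (S y) (p (α x)) (p (α (S y)))
      rw [Real.dist_eq] at this
      exact this.trans (by linarith [hp x, hp (S y)])
    have h1 := ae_all_iff.2 fun a : Fin m =>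
      tendsto_frequency μ (hα (measurableSet_singleton a))
    have h2 := ae_all_iff.2 fun a : Fin m =>
      tendsto_frequency μ (hαS (measurableSet_singleton a))
    filter_upwards [h1, h2] with x hx1 hx2
    set D : ℝ := Metric.diam (Set.univ : Set X)
    set E : ℕ → ℝ := fun n =>
      2 * (2 * ε) + D *
        (∑ a, |(∑ i : Fin n, if x i ∈ α ⁻¹' {a} then (1 : ℝ) else 0) / n - μ.real (α ⁻¹' {a})| +
        ∑ a, |(∑ i : Fin n, if x i ∈ (fun x => α (S x)) ⁻¹' {a} then (1 : ℝ) else 0) / n -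
          μ.real ((fun x => α (S x)) ⁻¹' {a})|)
    have hElim : Tendsto E atTop (nhds (2 * (2 * ε))) := by
      have : 2 * (2 * ε) = 2 * (2 * ε) + D * (∑ a : Fin m,
          |μ.real (α ⁻¹' {a}) - μ.real (α ⁻¹' {a})| + ∑ a : Fin m,
          |μ.real ((fun x => α (S x)) ⁻¹' {a}) - μ.real ((fun x => α (S x)) ⁻¹' {a})|) := by
        simp
      rw [this]
      exact ((tendsto_finsetSum _ fun a _ => ((hx1 a).sub_const _).abs).add
        (tendsto_finsetSum _ fun a _ => ((hx2 a).sub_const _).abs)).const_mul D |>.const_add _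
    filter_upwards [hElim.eventually_lt_const (u := 5 * ε) (by linarith),
      eventually_ge_atTop 1] with n hn hn1
    have : NeZero n := ⟨by omega⟩
    refine lt_of_le_of_lt ?_ hn
    rw [assignmentValue_eq_mkValue_uniformOn]
    -- For a fixed sample, indices inherit the labels of `x i` and `S (x i)`, whose uniform
    -- distributions are the sample frequencies in `E`.
    have h := abs_mkValue_sub_le_of_labels μ μ (uniformOn (Set.univ : Set (Fin n)))
      (uniformOn (Set.univ : Set (Fin n))) hα hαS
      (α' := fun i : Fin n => α (x i)) (β' := fun i : Fin n => α (S (x i)))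
      (measurable_of_finite _) (measurable_of_finite _) hf
      (c' := fun i j : Fin n => shiftedMetric S (x i) (x j)) (measurable_of_finite _)
      (fun _ _ => dist_nonneg) (fun _ _ => dist_nonneg)
      (C := fun a b => dist (p a) (p b)) (D := D) (fun _ _ => dist_nonneg)
      (fun a b => Metric.dist_le_diam_of_mem isCompact_univ.isBounded (Set.mem_univ _)
        (Set.mem_univ _)) Metric.diam_nonneg hcC (fun i j => hcC (x i) (x j))
    simp_rw [measureReal_uniformOn_univ_fin] at h
    exact h
  filter_upwards [ae_all_iff.2 key] with x hx
  rw [Metric.tendsto_nhds]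
  intro ε hε
  obtain ⟨k, hk⟩ := exists_nat_one_div_lt (show 0 < ε / 5 by positivity)
  filter_upwards [hx k] with n hn
  rw [Real.dist_eq]
  linarith

end MongeKantorovich

theorem theorem5 {X : Type*} [MetricSpace X] [CompactSpace X] [MeasurableSpace X] [BorelSpace X]
    (μ₁ μ₂ : Measure X) [IsProbabilityMeasure μ₁] [IsProbabilityMeasure μ₂]
    [NullSingletonClass μ₁] [NullSingletonClass μ₂]
    (S : X → X) (hS : MongeKantorovich.IsIsomorphismModZero μ₁ μ₂ S) :
    -- the law of the random matrix is a genuine probability measure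
    IsProbabilityMeasure
        (MongeKantorovich.symmMatrixDistribution μ₁ (MongeKantorovich.shiftedMetric S)) ∧
      -- the values of the finite problems are random variables
      (∀ n : ℕ, Measurable (MongeKantorovich.assignmentValue n)) ∧
      -- the problem for the shifted metric has the value of the original problem
      MongeKantorovich.mkValue (MongeKantorovich.shiftedMetric S) μ₁ μ₁ =
        MongeKantorovich.mkValue (fun x y : X => dist x y) μ₁ μ₂ ∧
      -- convergence in measure to this value
      TendstoInMeasure
        (MongeKantorovich.symmMatrixDistribution μ₁ (MongeKantorovich.shiftedMetric S))
        (fun (n : ℕ) (r : ℕ → ℕ → ℝ) => MongeKantorovich.assignmentValue n r) atTop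
        (fun _ => MongeKantorovich.mkValue (fun x y : X => dist x y) μ₁ μ₂) := by
  have hSm : Measurable S := hS.1.measurable
  have hr : Measurable fun (x : ℕ → X) (i j : ℕ) =>
      MongeKantorovich.shiftedMetric S (x i) (x j) :=
    measurable_pi_lambda _ fun i => measurable_pi_lambda _ fun j =>
      (measurable_pi_apply i).dist (hSm.comp (measurable_pi_apply j))
  have hprob : IsProbabilityMeasure
      (MongeKantorovich.symmMatrixDistribution μ₁ (MongeKantorovich.shiftedMetric S)) :=
    Measure.isProbabilityMeasure_map hr.aemeasurable
  have hval : MongeKantorovich.mkValue (MongeKantorovich.shiftedMetric S) μ₁ μ₁ =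
      MongeKantorovich.mkValue (fun x y : X => dist x y) μ₁ μ₂ :=
    MongeKantorovich.mkValue_comp_isomorphism hS measurable_dist
  refine ⟨hprob, MongeKantorovich.measurable_assignmentValue, hval, ?_⟩
  refine tendstoInMeasure_of_tendsto_ae
    (fun n => (MongeKantorovich.measurable_assignmentValue n).aestronglyMeasurable) ?_
  rw [← hval]
  -- Almost sure convergence passes from samples to the law of the matrix because the set of
  -- matrices where it holds is measurable.
  refine (ae_map_iff hr.aemeasurable ?_).2
    (MongeKantorovich.tendsto_assignmentValue_ae μ₁ hSm)
  exact measurableSet_tendsto _ fun n => MongeKantorovich.measurable_assignmentValue n
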